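/- There is an absolute constant $C\ge 1$ such that the following holds. Let $n,d,N_0$ be natural numbers with $d\ge 1$, $N_0\ge 1$, let $\varepsilon_0>0$, $\sigma>0$, $\alpha\in(0,1)$, and let $c>0$ with $c^{-1}>e$. Let $\mathcal M_0$ be a subset of the closed unit ball of $\mathbb R^n$ centred at the origin and let $\mu_0$ be a Borel probability measure with $\mu_0$-almost every point in $\mathcal M_0$, satisfying the lower-mass condition $$\mu_0(B(x,\varepsilon))>c\,\omega_d\,\varepsilon^d\qquad\text{for all }x\in\mathcal M_0,\ \varepsilon\in(0,2],$$ where $B(x,\varepsilon)$ is the closed Euclidean ball and $\omega_d$ is the volume of the unit ball of $\mathbb R^d$. Let $X_1,\dots,X_{N_0}$ be i.i.d. with law $\mu_0$, let $Z_1,\dots,Z_{N_0}$ be i.i.d. with law $\mathcal N(0,\sigma^2I_n)$, independent of $(X_i)$, and set $Y_i=X_i+Z_i$. Put $$D=\min\bigl(n,\lceil c^{-1}\omega_d^{-1}\varepsilon_0^{-d}\rceil\bigr),\qquad R=C\sigma\sqrt n+C\sigma\sqrt{\log(CN_0/\alpha)},$$ $$\varepsilon_{emp}=2(R+1)^2\,\frac{\sqrt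 D+2}{\sqrt{N_0}}\Bigl(1+\sqrt{2\ln(4/\alpha)}\Bigr),$$ and assume that $N_0$ is large enough that $\varepsilon_{emp}\le 1$. Let $S$ be any output of $D$-dimensional PCA on $Y_1,\dots,Y_{N_0}$, that is, a $D$-dimensional affine subspace minimizing $\sum_i\operatorname{dist}(Y_i,S)^2$ among all $D$-dimensional affine subspaces of $\mathbb R^n$ (if the minimizer is not unique, an arbitrary choice), and let $\Pi$ be the orthogonal projection onto $S$. Then the Hausdorff distance satisfies $$\mathbb P\left[\operatorname{dist}_H(\mathcal M_0,\Pi\mathcal M_0)\ \ge\ C\,d\,\Bigl(\frac{4\varepsilon_0^2+2\varepsilon_{emp}}{c}\Bigr)^{\frac1{d+2}}\right]\le C\alpha .$$ (If this event is not measurable, $\mathbb P$ denotes outer probability.) -/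

import Mathlib

open MeasureTheory ProbabilityTheory

noncomputable section

namespace ManifoldPCA

/-- The Euclidean space `ℝⁿ`. -/
abbrev E (n : ℕ) : Type := EuclideanSpace ℝ (Fin n)

/-- `ω_d`, the Lebesgue measure of the unit ball of `ℝᵈ`. -/
def unitBallVolume (d : ℕ) : ℝ :=
  (volume (Metric.ball (0 : E d) 1)).toReal

/-- The lower-mass condition: `μ₀ (B(x, ε)) > c ω_d εᵈ` for all `x ∈ M₀` and all `ε ∈ (0, 2]`. -/
def LowerMass {n : ℕ} (c : ℝ) (d : ℕ) (M₀ : Set (E n)) (μ₀ : Measure (E n)) : Prop :=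
  ∀ x ∈ M₀, ∀ ε : ℝ, 0 < ε → ε ≤ 2 →
    c * unitBallVolume d * ε ^ d < (μ₀ (Metric.closedBall x ε)).toReal

/-- The isotropic Gaussian distribution `N(0, σ² Iₙ)` on `ℝⁿ`. -/
def isoGaussian (n : ℕ) (σ : ℝ) : Measure (E n) :=
  multivariateGaussian 0 (σ ^ 2 • (1 : Matrix (Fin n) (Fin n) ℝ))

/-- The reduced dimension `D = min (n, ⌈c⁻¹ ω_d⁻¹ ε₀⁻ᵈ⌉)`. -/
def pcaDim (n d : ℕ) (c ε₀ : ℝ) : ℕ :=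
  min n ⌈c⁻¹ * (unitBallVolume d)⁻¹ * (ε₀ ^ d)⁻¹⌉₊

/-- `S` is an output of `D`-dimensional PCA on the data `y₁, …, y_N`: a `D`-dimensional affine
subspace minimizing the sum of squared distances to the data points among all `D`-dimensional
affine subspaces. (Minimizers need not be unique.) -/
structure IsPCAFit {n N : ℕ} (D : ℕ) (y : Fin N → E n) (S : AffineSubspace ℝ (E n)) : Prop where
  nonempty : (S : Set (E n)).Nonempty
  finrank_direction : Module.finrank ℝ S.direction = D
  optimal : ∀ T : AffineSubspace ℝ (E n), (T : Set (E n)).Nonempty →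
    Module.finrank ℝ T.direction = D →
    ∑ i, Metric.infDist (y i) S ^ 2 ≤ ∑ i, Metric.infDist (y i) T ^ 2

/-- The truncation radius `R = C σ √n + C σ √(log (C N₀ / α))`. -/
def truncRadius (C : ℝ) (n N₀ : ℕ) (σ α : ℝ) : ℝ :=
  C * σ * √(n : ℝ) + C * σ * √(Real.log (C * N₀ / α))

/-- `ε_emp = 2 (R + 1)² ((√D + 2) / √N₀) (1 + √(2 ln (4 / α)))`. -/
def epsEmp (R : ℝ) (D N₀ : ℕ) (α : ℝ) : ℝ :=
  2 * (R + 1) ^ 2 * ((√(D : ℝ) + 2) / √(N₀ : ℝ)) * (1 + √(2 * Real.log (4 / α)))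

end ManifoldPCA

end

/-! PCA minimizes an empirical risk. The proof compares its output with one good subspace, then
turns a small mean squared distance into a small uniform one.

Approximation: a maximal separated set in `M₀` has at most `c⁻¹ ω_d⁻¹ ε₀⁻ᵈ` points by disjointness
of balls, so its span, enlarged to dimension `D`, has risk at most `4 ε₀²`
(`exists_submodule_finrank_eq_pcaDim`).

Estimation: with high probability no noise vector exceeds `R`, so the noise may be truncated at `R`.
Truncated noise is bounded and still invariant under isometries, hence centred with isotropic
covariance; it shifts the risk of all `D`-dimensional subspaces by the same amount. Risks are linear
in the tensor `y ⊗ y`, so a dimension-free Hoeffding inequality in Hilbert space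
(`measure_pi_norm_sum_ge_le`), applied to this tensor and to the mean, controls all subspaces at
once. Pairing with a rank-`D` projection costs only its Frobenius norm `√D`. The excess risk is at
most `2 ε_emp` (`integral_infDist_sq_le_of_notMem_badSamples`).

From mean to uniform: a point of `M₀` at distance `r` from `S` has a ball of radius `r/2` around it
on which the distance is at least `r/2`, so lower mass and Markov give `c ω_d (r/2)^(d+2) ≤ risk`.
Since `ω_d ≥ d⁻ᵈ`, `r ≤ 2 d (risk / c)^(1/(d+2))` (`infDist_le_of_integral_infDist_sq_le`). -/

namespace ManifoldPCA

/-! ### Hoeffding's inequality in Hilbert space -/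

/-- Convexity of `u ↦ cosh √u`, in the form of a chord inequality. -/
lemma cosh_le_chord {p q r r₁ r₂ : ℝ} (hp : 0 ≤ p) (hq : 0 ≤ q) (hpq : p + q = 1)
    (h : r ^ 2 ≤ p * r₁ ^ 2 + q * r₂ ^ 2) :
    Real.cosh r ≤ p * Real.cosh r₁ + q * Real.cosh r₂ := by
  refine hasSum_le (fun k => ?_) (Real.hasSum_cosh r)
    (((Real.hasSum_cosh r₁).mul_left p).add ((Real.hasSum_cosh r₂).mul_left q))
  have h1 : (r ^ 2) ^ k ≤ p * (r₁ ^ 2) ^ k + q * (r₂ ^ 2) ^ k :=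
    (pow_le_pow_left₀ (sq_nonneg r) h k).trans
      ((convexOn_pow k).2 (sq_nonneg r₁) (sq_nonneg r₂) hp hq hpq)
  simp only [pow_mul]
  rw [← mul_div_assoc, ← mul_div_assoc, ← add_div]
  gcongr

section Hilbert

variable {H : Type*} [NormedAddCommGroup H] [InnerProductSpace ℝ H]

/-- An affine majorant of `w ↦ cosh ‖x + w‖` on the ball of radius `b`. -/
lemma exists_cosh_norm_add_le (x : H) {b : ℝ} (hb : 0 < b) :
    ∃ B : ℝ, ∀ w : H, ‖w‖ ≤ b →
      Real.cosh ‖x + w‖ ≤ Real.cosh ‖x‖ * Real.cosh b + B * inner ℝ x w := by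
  rcases eq_or_ne x 0 with rfl | hx
  · refine ⟨0, fun w hw => ?_⟩
    simpa [abs_of_pos hb] using hw
  have ha : 0 < ‖x‖ := norm_pos_iff.2 hx
  set a := ‖x‖ with ha_def
  refine ⟨Real.sinh a * Real.sinh b / (a * b), fun w hw => ?_⟩
  set s := inner ℝ x w with hs
  have habs : |s| ≤ a * b := (abs_real_inner_le_norm x w).trans (by gcongr)
  obtain ⟨hs1, hs2⟩ := abs_le.1 habs
  have hab : 0 < a * b := mul_pos ha hb
  -- The weights make the chord between `(a - b)²` and `(a + b)²` equal `a² + b² + 2s`, an upper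
  -- bound for `‖x + w‖²` that is affine in `s`.
  have key := cosh_le_chord (p := (a * b - s) / (2 * (a * b))) (q := (a * b + s) / (2 * (a * b)))
    (r := ‖x + w‖) (r₁ := a - b) (r₂ := a + b) (by apply div_nonneg <;> linarith)
    (by apply div_nonneg <;> linarith) (by field_simp; ring) (by
      have h1 : ‖x + w‖ ^ 2 = a ^ 2 + 2 * s + ‖w‖ ^ 2 := norm_add_sq_real x w
      have h2 : ‖w‖ ^ 2 ≤ b ^ 2 := by gcongr
      have h3 : (a * b - s) / (2 * (a * b)) * (a - b) ^ 2 + (a * b + s) / (2 * (a * b)) * (a + b) ^ 2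
          = a ^ 2 + b ^ 2 + 2 * s := by field_simp; ring
      linarith)
  refine key.trans (le_of_eq ?_)
  rw [Real.cosh_sub, Real.cosh_add]
  field_simp
  ring

variable [FiniteDimensional ℝ H] [MeasurableSpace H] [BorelSpace H]
  {A : Type*} [MeasurableSpace A] {ν : Measure A} [IsProbabilityMeasure ν]

/-- The linear term of the affine majorant integrates to zero because `φ` is centred. -/
lemma lintegral_cosh_norm_add_le {φ : A → H} (hφ : Measurable φ) {b : ℝ} (hb : 0 < b)
    (hφb : ∀ᵐ a ∂ν, ‖φ a‖ ≤ b) (h0 : ∫ a, φ a ∂ν = 0) (x : H) :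
    ∫⁻ a, ENNReal.ofReal (Real.cosh ‖x + φ a‖) ∂ν ≤
      ENNReal.ofReal (Real.cosh ‖x‖ * Real.cosh b) := by
  obtain ⟨B, hB⟩ := exists_cosh_norm_add_le x hb
  have hint : Integrable φ ν := Integrable.of_bound hφ.aestronglyMeasurable b hφb
  have hint2 : Integrable (fun a => Real.cosh ‖x‖ * Real.cosh b + B * inner ℝ x (φ a)) ν :=
    (integrable_const _).add ((hint.const_inner x).const_mul B)
  have hle : ∀ᵐ a ∂ν, Real.cosh ‖x + φ a‖ ≤
      Real.cosh ‖x‖ * Real.cosh b + B * inner ℝ x (φ a) := by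
    filter_upwards [hφb] with a ha using hB _ ha
  calc ∫⁻ a, ENNReal.ofReal (Real.cosh ‖x + φ a‖) ∂ν
      ≤ ∫⁻ a, ENNReal.ofReal (Real.cosh ‖x‖ * Real.cosh b + B * inner ℝ x (φ a)) ∂ν := by
        refine lintegral_mono_ae ?_
        filter_upwards [hle] with a ha using ENNReal.ofReal_le_ofReal ha
    _ = ENNReal.ofReal (∫ a, (Real.cosh ‖x‖ * Real.cosh b + B * inner ℝ x (φ a)) ∂ν) := by
        refine (ofReal_integral_eq_lintegral_ofReal hint2 ?_).symm
        filter_upwards [hle] with a ha using (Real.cosh_pos _).le.trans ha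
    _ = ENNReal.ofReal (Real.cosh ‖x‖ * Real.cosh b) := by
        rw [integral_add (integrable_const _) ((hint.const_inner x).const_mul B),
          integral_const, integral_const_mul, integral_inner hint, h0]
        simp

/-- Each summand costs a factor `cosh b`. The free starting point `x` lets the induction absorb the
first summand. -/
lemma lintegral_pi_cosh_norm_add_sum_le {φ : A → H} (hφ : Measurable φ) {b : ℝ} (hb : 0 < b)
    (hφb : ∀ᵐ a ∂ν, ‖φ a‖ ≤ b) (h0 : ∫ a, φ a ∂ν = 0) (N : ℕ) (x : H) :
    ∫⁻ a, ENNReal.ofReal (Real.cosh ‖x + ∑ i, φ (a i)‖) ∂(Measure.pi fun _ : Fin N => ν) ≤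
      ENNReal.ofReal (Real.cosh ‖x‖ * Real.cosh b ^ N) := by
  induction N generalizing x with
  | zero => simp
  | succ N ih =>
    have hmp := (measurePreserving_piFinSuccAbove (fun _ : Fin (N + 1) => ν) 0).symm
    rw [← hmp.lintegral_comp (by fun_prop)]
    have hm : Measurable fun a : Fin (N + 1) → A =>
        ENNReal.ofReal (Real.cosh ‖x + ∑ i, φ (a i)‖) := by fun_prop
    refine (lintegral_prod _ (hm.comp hmp.measurable).aemeasurable).trans_le ?_
    have hstep : ∀ a : A, ∫⁻ y : Fin N → A, ENNReal.ofReal (Real.cosh ‖x + ∑ i : Fin (N + 1),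
        φ ((MeasurableEquiv.piFinSuccAbove (fun _ : Fin (N + 1) => A) 0).symm (a, y) i)‖)
          ∂(Measure.pi fun _ : Fin N => ν) ≤
        ENNReal.ofReal (Real.cosh b ^ N) * ENNReal.ofReal (Real.cosh ‖x + φ a‖) := by
      intro a
      rw [← ENNReal.ofReal_mul (by positivity), mul_comm]
      refine le_trans (le_of_eq ?_) (ih (x + φ a))
      refine lintegral_congr fun y => ?_
      rw [Fin.sum_univ_succ, ← add_assoc]
      rfl
    refine (lintegral_mono fun a => hstep a).trans ?_
    rw [lintegral_const_mul _ (by fun_prop)]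
    refine (mul_le_mul_right (lintegral_cosh_norm_add_le hφ hb hφb h0 x) _).trans ?_
    rw [← ENNReal.ofReal_mul (by positivity)]
    apply le_of_eq
    congr 1
    ring

/-- **Hoeffding's inequality** for sums of independent bounded centred vectors of a Hilbert
space. -/
theorem measure_pi_norm_sum_ge_le {φ : A → H} (hφ : Measurable φ) {b : ℝ} (hb : 0 < b)
    (hφb : ∀ᵐ a ∂ν, ‖φ a‖ ≤ b) (h0 : ∫ a, φ a ∂ν = 0) {N : ℕ} (hN : 0 < N) {τ : ℝ}
    (hτ : 0 ≤ τ) :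
    (Measure.pi fun _ : Fin N => ν) {a | b * √N * τ ≤ ‖∑ i, φ (a i)‖} ≤
      ENNReal.ofReal (2 * Real.exp (-τ ^ 2 / 2)) := by
  have hN' : (0 : ℝ) < N := by exact_mod_cast hN
  have hsN : 0 < √(N : ℝ) := Real.sqrt_pos.2 hN'
  -- This scale optimizes the Chernoff bound `2 exp (-l b √N τ + N (l b)² / 2)`.
  set l : ℝ := τ / (b * √N) with hl
  have hl0 : 0 ≤ l := by positivity
  rcases hτ.eq_or_lt with rfl | hτ'
  · refine prob_le_one.trans ?_
    simp
  have hl1 : 0 < l := by positivity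
  have hmom := lintegral_pi_cosh_norm_add_sum_le (ν := ν) (φ := fun a => l • φ a)
    (hφ.const_smul l) (b := l * b) (by positivity) (by
      filter_upwards [hφb] with a ha
      rw [norm_smul, Real.norm_of_nonneg hl0]
      gcongr) (by rw [integral_smul, h0, smul_zero]) N 0
  have hmono : ENNReal.ofReal (Real.exp (τ ^ 2) / 2) *
      (Measure.pi fun _ : Fin N => ν) {a | b * √N * τ ≤ ‖∑ i, φ (a i)‖} ≤
      ENNReal.ofReal (Real.exp (τ ^ 2 / 2)) := by
    calc _ ≤ ENNReal.ofReal (Real.exp (τ ^ 2) / 2) * (Measure.pi fun _ : Fin N => ν)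
          {a | ENNReal.ofReal (Real.exp (τ ^ 2) / 2) ≤
            ENNReal.ofReal (Real.cosh ‖0 + ∑ i, l • φ (a i)‖)} := by
          gcongr with a
          intro ha
          apply ENNReal.ofReal_le_ofReal
          rw [zero_add, ← Finset.smul_sum, norm_smul, Real.norm_of_nonneg hl0]
          have h1 : τ ^ 2 ≤ l * ‖∑ i, φ (a i)‖ := by
            calc τ ^ 2 = l * (b * √N * τ) := by rw [hl]; field_simp
              _ ≤ _ := by gcongr
          have h2 := Real.exp_le_exp.2 h1
          have h3 := Real.exp_pos (-(l * ‖∑ i, φ (a i)‖))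
          rw [Real.cosh_eq]
          linarith
      _ ≤ _ := mul_meas_ge_le_lintegral (by fun_prop) _
      _ ≤ _ := hmom
      _ ≤ _ := by
        apply ENNReal.ofReal_le_ofReal
        rw [norm_zero, Real.cosh_zero, one_mul]
        calc Real.cosh (l * b) ^ N ≤ Real.exp ((l * b) ^ 2 / 2) ^ N := by
              gcongr
              exact Real.cosh_le_exp_half_sq _
          _ = Real.exp (τ ^ 2 / 2) := by
              rw [← Real.exp_nat_mul]
              congr 1
              have : (√(N : ℝ)) ^ 2 = N := Real.sq_sqrt hN'.le
              rw [hl, div_mul_eq_mul_div, div_pow, mul_pow, mul_pow, this]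
              field_simp
  have hpos : 0 < Real.exp (τ ^ 2) / 2 := by positivity
  rw [mul_comm, ← ENNReal.le_div_iff_mul_le (Or.inl (by simpa using hpos))
    (Or.inl ENNReal.ofReal_ne_top), ← ENNReal.ofReal_div_of_pos hpos] at hmono
  refine hmono.trans (ENNReal.ofReal_le_ofReal (le_of_eq ?_))
  rw [neg_div, Real.exp_neg, show τ ^ 2 = τ ^ 2 / 2 + τ ^ 2 / 2 by ring, Real.exp_add]
  field_simp
  try ring_nf

end Hilbert

/-! ### Isotropic Gaussian noise: invariance and norm tail -/

lemma isoGaussian_eq_map_smul (n : ℕ) (σ : ℝ) :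
    isoGaussian n σ = (stdGaussian (E n)).map (fun x => σ • x) := by
  have hS : (σ ^ 2 • (1 : Matrix (Fin n) (Fin n) ℝ)).PosSemidef :=
    Matrix.PosSemidef.one.smul (sq_nonneg σ)
  have : IsProbabilityMeasure ((stdGaussian (E n)).map (fun x => σ • x)) :=
    Measure.isProbabilityMeasure_map (by fun_prop)
  have : IsProbabilityMeasure (isoGaussian n σ) := by unfold isoGaussian; infer_instance
  apply Measure.ext_of_charFun
  ext t
  rw [isoGaussian, charFun_multivariateGaussian hS, charFun_map_smul, charFun_stdGaussian]
  congr 1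
  have h : ∑ i, t i * t i = ‖t‖ ^ 2 := by
    simp_rw [EuclideanSpace.real_norm_sq_eq, sq]
  simp only [inner_zero_right, Complex.ofReal_zero, zero_mul, zero_sub, Matrix.smul_mulVec,
    Matrix.one_mulVec, norm_smul, dotProduct_smul, smul_eq_mul]
  rw [show (t.ofLp ⬝ᵥ t.ofLp) = ‖t‖ ^ 2 from h]
  push_cast
  rw [mul_pow, ← Complex.ofReal_pow ‖σ‖, Real.norm_eq_abs, sq_abs]
  push_cast
  ring

instance isProbabilityMeasure_isoGaussian (n : ℕ) (σ : ℝ) :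
    IsProbabilityMeasure (isoGaussian n σ) := by
  unfold isoGaussian; infer_instance

lemma isoGaussian_map_linearIsometryEquiv {n : ℕ} (σ : ℝ) (f : E n ≃ₗᵢ[ℝ] E n) :
    (isoGaussian n σ).map f = isoGaussian n σ := by
  rw [isoGaussian_eq_map_smul, Measure.map_map (by fun_prop) (by fun_prop)]
  conv_rhs => rw [← stdGaussian_map f, Measure.map_map (by fun_prop) (by fun_prop)]
  congr 1
  ext1 x
  simp

/-- The integral equals `√2`, and `2 ≤ e`. -/
lemma lintegral_exp_sq_div_four_gaussianReal_le :
    ∫⁻ x, ENNReal.ofReal (Real.exp (x ^ 2 / 4)) ∂(gaussianReal 0 1) ≤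
      ENNReal.ofReal (Real.exp (1 / 2)) := by
  rw [gaussianReal_of_var_ne_zero _ one_ne_zero, lintegral_withDensity_eq_lintegral_mul _
    (by fun_prop) (by fun_prop)]
  have h1 : ∀ x : ℝ, (gaussianPDF 0 1 * fun x : ℝ => ENNReal.ofReal (Real.exp (x ^ 2 / 4))) x =
      ENNReal.ofReal ((√(2 * Real.pi))⁻¹ * Real.exp (-(1 / 4) * x ^ 2)) := by
    intro x
    rw [Pi.mul_apply, gaussianPDF, ← ENNReal.ofReal_mul (gaussianPDFReal_nonneg _ _ _),
      gaussianPDFReal, mul_assoc, ← Real.exp_add]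
    simp only [NNReal.coe_one, mul_one, sub_zero]
    congr 3
    ring
  simp_rw [h1]
  rw [← ofReal_integral_eq_lintegral_ofReal
    ((integrable_exp_neg_mul_sq (by norm_num)).const_mul _)
    (Filter.Eventually.of_forall fun x => by positivity), integral_const_mul, integral_gaussian]
  apply ENNReal.ofReal_le_ofReal
  rw [← Real.sqrt_inv, ← Real.sqrt_mul (by positivity)]
  have h2 : (2 * Real.pi)⁻¹ * (Real.pi / (1 / 4)) = 2 := by
    have := Real.pi_ne_zero
    field_simp
    norm_num
  rw [h2]
  have h3 : Real.exp (1 / 2) ^ 2 = Real.exp 1 := by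
    rw [← Real.exp_nat_mul]; norm_num
  rw [Real.sqrt_le_left (Real.exp_pos _).le, h3]
  have := Real.exp_one_gt_d9
  linarith

lemma lintegral_exp_norm_sq_stdGaussian_le (n : ℕ) :
    ∫⁻ x, ENNReal.ofReal (Real.exp (‖x‖ ^ 2 / 4)) ∂(stdGaussian (E n)) ≤
      ENNReal.ofReal (Real.exp (n / 2)) := by
  rw [← map_pi_eq_stdGaussian, lintegral_map (by fun_prop) (by fun_prop)]
  have h1 : ∀ x : Fin n → ℝ, ENNReal.ofReal (Real.exp (‖WithLp.toLp 2 x‖ ^ 2 / 4)) =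
      ∏ i, ENNReal.ofReal (Real.exp (x i ^ 2 / 4)) := by
    intro x
    rw [← ENNReal.ofReal_prod_of_nonneg (fun i _ => (Real.exp_pos _).le), ← Real.exp_sum,
      EuclideanSpace.real_norm_sq_eq, Finset.sum_div]
  simp_rw [h1]
  rw [lintegral_prod_eq_prod_lintegral_of_indepFun Finset.univ
    (fun (i : Fin n) (x : Fin n → ℝ) => ENNReal.ofReal (Real.exp (x i ^ 2 / 4)))
    (iIndepFun_pi (X := fun _ y => ENNReal.ofReal (Real.exp (y ^ 2 / 4)))
      fun i => by fun_prop) (fun i => by fun_prop)]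
  have h2 : ∀ i : Fin n, ∫⁻ x : Fin n → ℝ, ENNReal.ofReal (Real.exp (x i ^ 2 / 4))
      ∂(Measure.pi fun _ : Fin n => gaussianReal 0 1) ≤ ENNReal.ofReal (Real.exp (1 / 2)) := by
    intro i
    rw [(measurePreserving_eval (fun _ : Fin n => gaussianReal 0 1) i).lintegral_comp
      (f := fun y => ENNReal.ofReal (Real.exp (y ^ 2 / 4))) (by fun_prop)]
    exact lintegral_exp_sq_div_four_gaussianReal_le
  refine (Finset.prod_le_prod' fun i _ => h2 i).trans ?_
  rw [Finset.prod_const, Finset.card_univ, Fintype.card_fin, ← ENNReal.ofReal_pow (by positivity),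
    ← Real.exp_nat_mul]
  apply le_of_eq
  congr 2
  ring

/-- Chernoff bound with the moment of `exp (‖x‖² / 4)`: on the event, `‖x‖² / 4 ≥ n / 2 + u` for the
standardized vector. -/
lemma isoGaussian_norm_gt_le {n : ℕ} {σ r u : ℝ} (hσ : 0 < σ) (hr : 0 ≤ r)
    (h : σ ^ 2 * (2 * n + 4 * u) ≤ r ^ 2) :
    isoGaussian n σ {z | r < ‖z‖} ≤ ENNReal.ofReal (Real.exp (-u)) := by
  have hms : MeasurableSet {z : E n | r < ‖z‖} := measurableSet_lt (by fun_prop) (by fun_prop)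
  rw [isoGaussian_eq_map_smul, Measure.map_apply (by fun_prop) hms]
  have hpos : (0 : ℝ) < Real.exp (n / 2 + u) := Real.exp_pos _
  have key : ENNReal.ofReal (Real.exp (n / 2 + u)) * (stdGaussian (E n))
      ((fun x => σ • x) ⁻¹' {z | r < ‖z‖}) ≤ ENNReal.ofReal (Real.exp (n / 2)) := by
    calc _ ≤ ENNReal.ofReal (Real.exp (n / 2 + u)) * (stdGaussian (E n))
          {x | ENNReal.ofReal (Real.exp (n / 2 + u)) ≤
            ENNReal.ofReal (Real.exp (‖x‖ ^ 2 / 4))} := by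
          gcongr
          intro x hx
          simp only [Set.mem_preimage, Set.mem_ofPred_eq, norm_smul, Real.norm_of_nonneg hσ.le]
            at hx ⊢
          apply ENNReal.ofReal_le_ofReal
          apply Real.exp_le_exp.2
          have h1 : σ ^ 2 * (2 * n + 4 * u) ≤ σ ^ 2 * ‖x‖ ^ 2 := by
            rw [← mul_pow]
            exact h.trans (by gcongr)
          have h2 := le_of_mul_le_mul_left h1 (by positivity)
          linarith
      _ ≤ _ := mul_meas_ge_le_lintegral (by fun_prop) _
      _ ≤ _ := lintegral_exp_norm_sq_stdGaussian_le n
  rw [mul_comm, ← ENNReal.le_div_iff_mul_le (Or.inl (by simpa using hpos))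
    (Or.inl ENNReal.ofReal_ne_top), ← ENNReal.ofReal_div_of_pos hpos, ← Real.exp_sub] at key
  refine key.trans (le_of_eq ?_)
  congr 2
  ring

/-! ### Truncated noise is centred and isotropic -/

/-- Truncation of a vector to the closed ball of radius `r`, by zero outside. -/
noncomputable def trunc {n : ℕ} (r : ℝ) (z : E n) : E n :=
  (Metric.closedBall 0 r).indicator id z

section Truncation

variable {n : ℕ} {r : ℝ}

lemma trunc_of_norm_le {z : E n} (h : ‖z‖ ≤ r) : trunc r z = z := by
  simp [trunc, h]

lemma norm_trunc_le (hr : 0 ≤ r) (z : E n) : ‖trunc r z‖ ≤ r := by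
  by_cases h : ‖z‖ ≤ r
  · rwa [trunc_of_norm_le h]
  · simp [trunc, h, hr]

@[fun_prop]
lemma measurable_trunc : Measurable (trunc r : E n → E n) :=
  measurable_id.indicator Metric.isClosed_closedBall.measurableSet

lemma trunc_linearIsometryEquiv (f : E n ≃ₗᵢ[ℝ] E n) (z : E n) :
    trunc r (f z) = f (trunc r z) := by
  by_cases h : ‖z‖ ≤ r <;> simp [trunc, h]

lemma integral_trunc_isoGaussian (n : ℕ) (σ r : ℝ) :
    ∫ z, trunc r z ∂(isoGaussian n σ) = 0 := by
  have h : ∫ z, trunc r z ∂(isoGaussian n σ) = -∫ z, trunc r z ∂(isoGaussian n σ) := by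
    conv_lhs => rw [← isoGaussian_map_linearIsometryEquiv σ (LinearIsometryEquiv.neg ℝ)]
    rw [integral_map (by fun_prop) (by fun_prop)]
    simp_rw [trunc_linearIsometryEquiv]
    simp [integral_neg]
  have h2 : (2 : ℝ) • ∫ z, trunc r z ∂(isoGaussian n σ) = 0 := by
    rw [two_smul]
    nth_rewrite 1 [h]
    simp
  simpa using h2

/-- The truncated isotropic Gaussian has isotropic covariance. -/
lemma exists_integral_inner_trunc_sq_eq (n : ℕ) (σ r : ℝ) :
    ∃ s : ℝ, ∀ v : E n, ‖v‖ = 1 → ∫ z, (inner ℝ (trunc r z) v) ^ 2 ∂(isoGaussian n σ) = s := by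
  by_cases hw : ∃ w : E n, ‖w‖ = 1
  · obtain ⟨w, hw⟩ := hw
    refine ⟨∫ z, (inner ℝ (trunc r z) w) ^ 2 ∂(isoGaussian n σ), fun v hv => ?_⟩
    -- Reflection exchanging the unit vectors `v` and `w`; it preserves the Gaussian and commutes
    -- with truncation.
    set f : E n ≃ₗᵢ[ℝ] E n := (ℝ ∙ (v - w))ᗮ.reflection with hf
    have hfv : f w = v := by
      have h := Submodule.reflection_sub (hv.trans hw.symm)
      rw [← h, hf]
      exact Submodule.reflection_reflection _ _
    conv_lhs => rw [← isoGaussian_map_linearIsometryEquiv σ f]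
    rw [integral_map (by fun_prop) (by fun_prop)]
    refine integral_congr_ae (Filter.Eventually.of_forall fun z => ?_)
    simp only
    rw [trunc_linearIsometryEquiv, ← hfv, f.inner_map_map]
  · exact ⟨0, fun v hv => (hw ⟨v, hv⟩).elim⟩

end Truncation

/-! ### Linearizing quadratic risks by rank-one tensors -/

section Tensor

variable {n : ℕ}

/-- The rank-one tensor `y ⊗ y`, as a vector of the Euclidean space of `n × n` arrays. -/
noncomputable def tensorSq (y : E n) : EuclideanSpace ℝ (Fin n × Fin n) :=
  WithLp.toLp 2 fun p => y p.1 * y p.2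

lemma inner_tensorSq (y u : E n) : inner ℝ (tensorSq y) (tensorSq u) = (inner ℝ y u) ^ 2 := by
  simp only [tensorSq, PiLp.inner_apply, Fintype.sum_prod_type, sq, Finset.sum_mul_sum]
  refine Finset.sum_congr rfl fun i _ => Finset.sum_congr rfl fun j _ => ?_
  simp
  ring

lemma norm_tensorSq (y : E n) : ‖tensorSq y‖ = ‖y‖ ^ 2 := by
  have h : ‖tensorSq y‖ ^ 2 = (‖y‖ ^ 2) ^ 2 := by
    rw [← real_inner_self_eq_norm_sq, inner_tensorSq, real_inner_self_eq_norm_sq]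
  exact (sq_eq_sq₀ (norm_nonneg _) (by positivity)).1 h

@[fun_prop]
lemma continuous_tensorSq : Continuous (tensorSq : E n → _) := by
  unfold tensorSq
  fun_prop

/-- The orthogonal projection onto `V`, as a vector of the Euclidean space of `n × n` arrays. -/
noncomputable def projTensor (V : Submodule ℝ (E n)) : EuclideanSpace ℝ (Fin n × Fin n) :=
  ∑ k, tensorSq (stdOrthonormalBasis ℝ V k : E n)

lemma norm_sq_starProjection_eq_sum (V : Submodule ℝ (E n)) (y : E n) :
    ‖V.starProjection y‖ ^ 2 = ∑ k, (inner ℝ y (stdOrthonormalBasis ℝ V k : E n)) ^ 2 := by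
  rw [Submodule.starProjection_apply, ← Submodule.coe_norm,
    ← (stdOrthonormalBasis ℝ V).sum_sq_inner_left]
  refine Finset.sum_congr rfl fun k _ => ?_
  rw [Submodule.coe_inner, ← Submodule.starProjection_apply,
    Submodule.inner_starProjection_left_eq_right,
    Submodule.starProjection_eq_self_iff.2 (Subtype.coe_prop _)]

lemma inner_tensorSq_projTensor (V : Submodule ℝ (E n)) (y : E n) :
    inner ℝ (tensorSq y) (projTensor V) = ‖V.starProjection y‖ ^ 2 := by
  rw [norm_sq_starProjection_eq_sum, projTensor, inner_sum]
  simp_rw [inner_tensorSq]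

/-- This Frobenius norm is the source of the factor `√D` in `ε_emp`. -/
lemma norm_projTensor (V : Submodule ℝ (E n)) :
    ‖projTensor V‖ = √(Module.finrank ℝ V : ℝ) := by
  rw [← Real.sqrt_sq (norm_nonneg _), ← real_inner_self_eq_norm_sq]
  congr 1
  conv_lhs => rw [projTensor, sum_inner]
  have h : ∀ k, inner ℝ (tensorSq (stdOrthonormalBasis ℝ V k : E n)) (projTensor V) = 1 := by
    intro k
    rw [inner_tensorSq_projTensor, Submodule.starProjection_eq_self_iff.2 (Subtype.coe_prop _),
      ← Submodule.coe_norm, (stdOrthonormalBasis ℝ V).norm_eq_one, one_pow]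
  rw [← projTensor]
  simp [h]

end Tensor

/-! ### Excess risk of a PCA fit -/

section Fit

variable {n N D : ℕ}

lemma infDist_affineSubspace_eq {S : AffineSubspace ℝ (E n)} {p : E n} (hp : p ∈ S) (x : E n) :
    Metric.infDist x S = ‖S.directionᗮ.starProjection x - S.directionᗮ.starProjection p‖ := by
  have : Nonempty S := ⟨⟨p, hp⟩⟩
  rw [← EuclideanGeometry.dist_orthogonalProjection_eq_infDist,
    EuclideanGeometry.orthogonalProjection_apply_mem S hp, ← map_sub,
    Submodule.starProjection_orthogonal_val, dist_eq_norm]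
  congr 1
  simp only [vsub_eq_sub, vadd_eq_add, Submodule.starProjection_apply]
  abel

/-- The bias-variance identity. -/
lemma sum_norm_sub_sq_eq {F : Type*} [NormedAddCommGroup F] [InnerProductSpace ℝ F]
    (z : Fin N → F) {m : F} (hm : ∑ i, z i = (N : ℝ) • m) (q : F) :
    ∑ i, ‖z i - q‖ ^ 2 = ∑ i, ‖z i‖ ^ 2 - N * (2 * inner ℝ m q - ‖q‖ ^ 2) := by
  have h : ∀ i, ‖z i - q‖ ^ 2 = ‖z i‖ ^ 2 - (2 * inner ℝ (z i) q - ‖q‖ ^ 2) := fun i => by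
    rw [norm_sub_sq_real]; ring
  simp_rw [h, Finset.sum_sub_distrib, ← Finset.mul_sum, ← sum_inner, hm, inner_smul_left]
  simp
  ring

/-- Otherwise translating `S` to pass through the empirical mean would strictly lower the sum, by
the bias-variance identity. -/
lemma starProjection_orthogonal_eq_of_isPCAFit (hN : 0 < N) {y : Fin N → E n}
    {S : AffineSubspace ℝ (E n)} (hS : IsPCAFit D y S) {ybar : E n}
    (hy : ∑ i, y i = (N : ℝ) • ybar) {p : E n} (hp : p ∈ S) :
    S.directionᗮ.starProjection p = S.directionᗮ.starProjection ybar := by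
  have h := hS.optimal (AffineSubspace.mk' ybar S.direction)
    ⟨ybar, AffineSubspace.self_mem_mk' _ _⟩ (by
      rw [AffineSubspace.direction_mk']; exact hS.finrank_direction)
  simp_rw [infDist_affineSubspace_eq hp,
    infDist_affineSubspace_eq (AffineSubspace.self_mem_mk' ybar S.direction),
    AffineSubspace.direction_mk'] at h
  have hz : ∑ i, S.directionᗮ.starProjection (y i) =
      (N : ℝ) • S.directionᗮ.starProjection ybar := by
    rw [← map_sum, hy, map_smul]
  rw [sum_norm_sub_sq_eq _ hz, sum_norm_sub_sq_eq _ hz, real_inner_self_eq_norm_sq] at h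
  have hN' : (0 : ℝ) < N := by exact_mod_cast hN
  set q := S.directionᗮ.starProjection p
  set m := S.directionᗮ.starProjection ybar
  have h1 : ‖m - q‖ ^ 2 = ‖m‖ ^ 2 - 2 * inner ℝ m q + ‖q‖ ^ 2 := norm_sub_sq_real _ _
  have h2 : (N : ℝ) * (2 * ‖m‖ ^ 2 - ‖m‖ ^ 2) ≤ N * (2 * inner ℝ m q - ‖q‖ ^ 2) := by linarith
  have h3 := le_of_mul_le_mul_left h2 hN'
  have h4 : ‖m - q‖ ^ 2 ≤ 0 := by linarith
  have h5 : m - q = 0 := by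
    rw [← norm_eq_zero]
    exact pow_eq_zero_iff two_ne_zero |>.1 (le_antisymm h4 (sq_nonneg _))
  exact (sub_eq_zero.1 h5).symm

/-- Deterministic excess-risk bound for PCA in terms of the errors of the empirical second-moment
tensor and of the empirical mean. -/
lemma integral_infDist_sq_le_of_isPCAFit (hN : 0 < N) {μ₀ : Measure (E n)}
    [IsProbabilityMeasure μ₀] (hμ : ∀ᵐ x ∂μ₀, ‖x‖ ≤ 1) {y : Fin N → E n}
    {S : AffineSubspace ℝ (E n)} (hS : IsPCAFit D y S) (U : Submodule ℝ (E n))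
    (hU : Module.finrank ℝ U = D) {M : EuclideanSpace ℝ (Fin n × Fin n)} {s : ℝ}
    (hM : ∀ V : Submodule ℝ (E n), Module.finrank ℝ V = D →
      inner ℝ M (projTensor V) = ∫ x, ‖V.starProjection x‖ ^ 2 ∂μ₀ + s)
    {ρ Δ δ : ℝ} (hy : ∀ i, ‖y i‖ ≤ ρ)
    (hΔ : ‖∑ i, (tensorSq (y i) - M)‖ ≤ N * Δ)
    (hδ : ‖∑ i, (y i - ∫ x, x ∂μ₀)‖ ≤ N * δ) :
    ∫ x, Metric.infDist x S ^ 2 ∂μ₀ ≤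
      ∫ x, ‖Uᗮ.starProjection x‖ ^ 2 ∂μ₀ + 2 * √(D : ℝ) * Δ + 2 * ρ * δ := by
  have hN' : (0 : ℝ) < N := by exact_mod_cast hN
  obtain ⟨p, hp⟩ := hS.nonempty
  have hint : Integrable (fun x : E n => x) μ₀ :=
    Integrable.of_bound (by fun_prop) 1 hμ
  have hsq : ∀ V : Submodule ℝ (E n), Integrable (fun x => ‖V.starProjection x‖ ^ 2) μ₀ :=
    fun V => Integrable.of_bound (by fun_prop) 1 (by
      filter_upwards [hμ] with x hx
      rw [Real.norm_of_nonneg (by positivity)]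
      exact pow_le_one₀ (norm_nonneg _) ((V.norm_starProjection_apply_le x).trans hx))
  have hsq0 : Integrable (fun x : E n => ‖x‖ ^ 2) μ₀ := by
    simpa [Submodule.starProjection_top'] using hsq ⊤
  have hpyth : ∀ V : Submodule ℝ (E n), ∫ x, ‖V.starProjection x‖ ^ 2 ∂μ₀ =
      ∫ x, ‖x‖ ^ 2 ∂μ₀ - ∫ x, ‖Vᗮ.starProjection x‖ ^ 2 ∂μ₀ := by
    intro V
    rw [← integral_sub hsq0 (hsq _)]
    refine integral_congr_ae (Filter.Eventually.of_forall fun x => ?_)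
    simp only
    rw [Submodule.norm_sq_eq_add_norm_sq_starProjection x V]
    ring
  set V := S.direction with hV
  set m := ∫ x, x ∂μ₀ with hm
  set ybar : E n := (N : ℝ)⁻¹ • ∑ i, y i with hybar
  have hsum : ∑ i, y i = (N : ℝ) • ybar := by
    rw [hybar, smul_smul, mul_inv_cancel₀ hN'.ne', one_smul]
  have hq := starProjection_orthogonal_eq_of_isPCAFit hN hS hsum hp
  set Q := Vᗮ.starProjection with hQ
  have hdist : ∀ x, Metric.infDist x S = ‖Q x - Q ybar‖ := fun x => by
    rw [infDist_affineSubspace_eq hp, hq]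
  have hρ : ‖ybar‖ ≤ ρ := by
    rw [hybar, norm_smul, norm_inv, Real.norm_natCast, inv_mul_le_iff₀ hN']
    calc ‖∑ i, y i‖ ≤ ∑ i : Fin N, ρ := norm_sum_le_of_le _ fun i _ => hy i
      _ = N * ρ := by simp
  have hδ' : ‖ybar - m‖ ≤ δ := by
    have h : ∑ i, (y i - m) = (N : ℝ) • (ybar - m) := by
      rw [Finset.sum_sub_distrib, hsum, smul_sub]
      simp [Nat.cast_smul_eq_nsmul]
    rw [h, norm_smul, Real.norm_natCast] at hδ
    exact le_of_mul_le_mul_left hδ hN'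
  have hlhs : ∫ x, Metric.infDist x S ^ 2 ∂μ₀ =
      ∫ x, ‖Q x‖ ^ 2 ∂μ₀ - 2 * inner ℝ (Q m) (Q ybar) + ‖Q ybar‖ ^ 2 := by
    simp_rw [hdist, norm_sub_sq_real]
    have hi : Integrable (fun x => 2 * inner ℝ (Q x) (Q ybar)) μ₀ :=
      ((Q.integrable_comp hint).inner_const _).const_mul 2
    have hQsq : Integrable (fun x => ‖Q x‖ ^ 2) μ₀ := hsq Vᗮ
    have hsub : Integrable (fun x => ‖Q x‖ ^ 2 - 2 * inner ℝ (Q x) (Q ybar)) μ₀ := hQsq.sub hi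
    rw [integral_add hsub (integrable_const _), integral_sub hQsq hi, integral_const_mul]
    simp_rw [real_inner_comm (Q ybar)]
    rw [integral_inner (Q.integrable_comp hint), Q.integral_comp_comm hint, ← hm]
    simp
  have hopt := hS.optimal U.toAffineSubspace ⟨0, U.zero_mem⟩ (by
    rw [Submodule.toAffineSubspace_direction]; exact hU)
  have hUd : ∀ x, Metric.infDist x (U.toAffineSubspace : Set (E n)) = ‖Uᗮ.starProjection x‖ := by
    intro x
    rw [infDist_affineSubspace_eq (p := 0) (S := U.toAffineSubspace) U.zero_mem]
    simp [Submodule.toAffineSubspace_direction]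
  simp_rw [hUd, hdist] at hopt
  have hz : ∑ i, Q (y i) = (N : ℝ) • Q ybar := by rw [← map_sum, hsum, map_smul]
  rw [sum_norm_sub_sq_eq _ hz, real_inner_self_eq_norm_sq] at hopt
  set T := ∑ i, (tensorSq (y i) - M) with hT
  -- The isotropic shift `s` is the same for both subspaces, so it cancels in the comparison.
  have hproj : ∀ V' : Submodule ℝ (E n), Module.finrank ℝ V' = D →
      ∑ i, ‖V'ᗮ.starProjection (y i)‖ ^ 2 =
        ∑ i, ‖y i‖ ^ 2 - (inner ℝ T (projTensor V') +
          N * (∫ x, ‖V'.starProjection x‖ ^ 2 ∂μ₀ + s)) := by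
    intro V' hV'
    rw [hT, ← hM V' hV', sum_inner]
    simp_rw [inner_sub_left, inner_tensorSq_projTensor]
    rw [Finset.sum_sub_distrib]
    simp only [Finset.sum_const, Finset.card_univ, Fintype.card_fin, nsmul_eq_mul]
    rw [sub_add_cancel, ← Finset.sum_sub_distrib]
    refine Finset.sum_congr rfl fun i _ => ?_
    rw [Submodule.norm_sq_eq_add_norm_sq_starProjection (y i) V']
    ring
  rw [hproj V hS.finrank_direction, hproj U hU, hpyth V, hpyth U, ← hQ] at hopt
  have hTV : |inner ℝ T (projTensor V)| ≤ N * Δ * √(D : ℝ) := by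
    refine (abs_real_inner_le_norm _ _).trans ?_
    rw [norm_projTensor, hS.finrank_direction]
    gcongr
  have hTU : |inner ℝ T (projTensor U)| ≤ N * Δ * √(D : ℝ) := by
    refine (abs_real_inner_le_norm _ _).trans ?_
    rw [norm_projTensor, hU]
    gcongr
  have hrisk : ∫ x, ‖Q x‖ ^ 2 ∂μ₀ ≤
      ∫ x, ‖Uᗮ.starProjection x‖ ^ 2 ∂μ₀ + 2 * √(D : ℝ) * Δ + ‖Q ybar‖ ^ 2 := by
    refine le_of_mul_le_mul_left ?_ hN'
    have h1 := (abs_le.1 hTV).2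
    have h2 := (abs_le.1 hTU).1
    linarith
  -- Only the error of the mean remains from the affine offset: the two terms combine into an inner
  -- product with `Q (ybar - m)`.
  have hcross : 2 * ‖Q ybar‖ ^ 2 - 2 * inner ℝ (Q m) (Q ybar) ≤ 2 * ρ * δ := by
    have h1 : 2 * ‖Q ybar‖ ^ 2 - 2 * inner ℝ (Q m) (Q ybar) =
        2 * inner ℝ (Q (ybar - m)) (Q ybar) := by
      rw [map_sub, inner_sub_left, real_inner_self_eq_norm_sq]
      ring
    rw [h1]
    have h2 : inner ℝ (Q (ybar - m)) (Q ybar) ≤ δ * ρ := by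
      refine (real_inner_le_norm _ _).trans ?_
      have h3 := (Vᗮ.norm_starProjection_apply_le (ybar - m)).trans hδ'
      have h4 := (Vᗮ.norm_starProjection_apply_le ybar).trans hρ
      have h5 : 0 ≤ δ := (norm_nonneg _).trans h3
      gcongr
    linarith
  rw [hlhs]
  linarith

end Fit

/-! ### A lower bound for the volume of the unit ball -/

section Volume

lemma unitBallVolume_eq {d : ℕ} (hd : 0 < d) :
    unitBallVolume d = √Real.pi ^ d / Real.Gamma (d / 2 + 1) := by
  have : Nonempty (Fin d) := ⟨⟨0, hd⟩⟩
  have hG : 0 < Real.Gamma ((d : ℝ) / 2 + 1) := Real.Gamma_pos_of_pos (by positivity)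
  rw [unitBallVolume, EuclideanSpace.volume_ball]
  simp only [ENNReal.ofReal_one, one_pow, one_mul, Fintype.card_fin]
  exact ENNReal.toReal_ofReal (by positivity)

lemma unitBallVolume_pos {d : ℕ} (hd : 0 < d) : 0 < unitBallVolume d := by
  have hG : 0 < Real.Gamma ((d : ℝ) / 2 + 1) := Real.Gamma_pos_of_pos (by positivity)
  rw [unitBallVolume_eq hd]
  positivity

/-- Log-convexity of `Γ` gives `Γ(d/2 + 1) ≤ √(d!) ≤ dᵈ`, while `√π ≥ 1`. -/
lemma one_le_unitBallVolume_mul_pow {d : ℕ} (hd : 0 < d) : 1 ≤ unitBallVolume d * (d : ℝ) ^ d := by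
  have hG : 0 < Real.Gamma ((d : ℝ) / 2 + 1) := Real.Gamma_pos_of_pos (by positivity)
  have h1 : Real.Gamma ((d : ℝ) / 2 + 1) ≤ (d : ℝ) ^ d := by
    have h2 := Real.Gamma_mul_add_mul_le_rpow_Gamma_mul_rpow_Gamma (s := (d : ℝ) + 1) (t := 1)
      (a := 1 / 2) (b := 1 / 2) (by positivity) one_pos (by norm_num) (by norm_num) (by norm_num)
    simp only [Real.Gamma_nat_eq_factorial, Real.Gamma_one, Real.one_rpow, mul_one] at h2
    have h3 : (1 : ℝ) ≤ (d.factorial : ℝ) := by exact_mod_cast d.factorial_pos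
    calc Real.Gamma ((d : ℝ) / 2 + 1) = Real.Gamma (1 / 2 * ((d : ℝ) + 1) + 1 / 2) := by
          congr 1; ring
      _ ≤ (d.factorial : ℝ) ^ (1 / 2 : ℝ) := h2
      _ ≤ (d.factorial : ℝ) ^ (1 : ℝ) := Real.rpow_le_rpow_of_exponent_le h3 (by norm_num)
      _ = d.factorial := Real.rpow_one _
      _ ≤ (d : ℝ) ^ d := by exact_mod_cast d.factorial_le_pow
  have h4 : (1 : ℝ) ≤ √Real.pi := by
    rw [Real.one_le_sqrt]
    linarith [Real.pi_gt_three]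
  rw [unitBallVolume_eq hd, div_mul_eq_mul_div, le_div_iff₀ hG, one_mul]
  exact h1.trans (le_mul_of_one_le_left (by positivity) (one_le_pow₀ h4))

end Volume

/-! ### Separated nets and enlargement of subspaces -/

section Net

/-- A maximal separated subset of a set whose points all have neighbourhoods of large mass. -/
lemma exists_finset_cover {X : Type*} [PseudoMetricSpace X] [MeasurableSpace X]
    [OpensMeasurableSpace X] (μ : Measure X) [IsProbabilityMeasure μ] (M : Set X) {r β : ℝ}
    (hβ : 0 < β) (h : ∀ x ∈ M, β < (μ (Metric.closedBall x r)).toReal) :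
    ∃ t : Finset X, (t.card : ℝ) * β ≤ 1 ∧ ∀ x ∈ M, ∃ y ∈ t, dist x y ≤ 2 * r := by
  classical
  set Sep : ℕ → Prop := fun k => ∃ t : Finset X, (t : Set X) ⊆ M ∧ t.card = k ∧
    (t : Set X).Pairwise fun x y => 2 * r < dist x y with hSep
  have hcard : ∀ t : Finset X, (t : Set X) ⊆ M →
      ((t : Set X).Pairwise fun x y => 2 * r < dist x y) → (t.card : ℝ) * β ≤ 1 := by
    intro t ht hp
    have hdisj : (t : Set X).PairwiseDisjoint fun x => Metric.closedBall x r :=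
      fun x hx y hy hxy => Metric.closedBall_disjoint_closedBall (by linarith [hp hx hy hxy])
    calc (t.card : ℝ) * β = ∑ x ∈ t, β := by simp
      _ ≤ ∑ x ∈ t, μ.real (Metric.closedBall x r) := Finset.sum_le_sum fun x hx => (h x (ht hx)).le
      _ = μ.real (⋃ x ∈ t, Metric.closedBall x r) :=
        (measureReal_biUnion_finset hdisj fun x _ => Metric.isClosed_closedBall.measurableSet).symm
      _ ≤ 1 := measureReal_le_one
  -- Cardinalities of separated sets are bounded by `1 / β`, so some `k` cannot be increased.
  obtain ⟨k, hk, hk'⟩ : ∃ k, Sep k ∧ ¬ Sep (k + 1) := by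
    by_contra! hcon
    have hall : ∀ k, Sep k := fun k => by
      induction k with
      | zero => exact ⟨∅, by simp, rfl, by simp⟩
      | succ k ih => exact hcon k ih
    obtain ⟨k, hk⟩ := exists_nat_gt (1 / β)
    obtain ⟨t, ht, rfl, hp⟩ := hall k
    have h1 := hcard t ht hp
    rw [div_lt_iff₀ hβ] at hk
    linarith
  obtain ⟨t, ht, hkt, hp⟩ := hk
  refine ⟨t, hcard t ht hp, fun x hx => ?_⟩
  by_contra! hfar
  apply hk'
  have hr : 0 ≤ r := by
    by_contra! hr
    have h1 := h x hx
    rw [Metric.closedBall_eq_empty.2 hr] at h1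
    simp at h1
    linarith
  have hxt : x ∉ t := fun hxt => by
    have h1 := hfar x hxt
    rw [dist_self] at h1
    linarith
  refine ⟨insert x t, ?_, by rw [Finset.card_insert_of_notMem hxt, hkt], ?_⟩
  · rw [Finset.coe_insert]
    exact Set.insert_subset hx ht
  · rw [Finset.coe_insert]
    refine hp.insert fun y hy _ => ⟨hfar y hy, ?_⟩
    rw [dist_comm]
    exact hfar y hy

lemma exists_submodule_ge_finrank_eq {V : Type*} [AddCommGroup V] [Module ℝ V]
    [FiniteDimensional ℝ V] (K : Submodule ℝ V) (k : ℕ)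
    (hk : Module.finrank ℝ K + k ≤ Module.finrank ℝ V) :
    ∃ U : Submodule ℝ V, K ≤ U ∧ Module.finrank ℝ U = Module.finrank ℝ K + k := by
  induction k with
  | zero => exact ⟨K, le_rfl, rfl⟩
  | succ k ih =>
    obtain ⟨U, hKU, hU⟩ := ih (by omega)
    obtain ⟨v, hv⟩ := Submodule.exists_of_finrank_lt U (by omega)
    have hvU : v ∉ U := by simpa using hv 1 one_ne_zero
    refine ⟨U ⊔ Submodule.span ℝ {v}, hKU.trans le_sup_left, le_antisymm ?_ ?_⟩
    · refine (Submodule.finrank_add_le_finrank_add_finrank _ _).trans ?_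
      have h1 := finrank_span_le_card (R := ℝ) ({v} : Set V)
      simp only [Set.toFinset_singleton, Finset.card_singleton] at h1
      omega
    · have hlt : U < U ⊔ Submodule.span ℝ {v} := by
        refine lt_of_le_of_ne le_sup_left fun heq => hvU ?_
        rw [heq]
        exact Submodule.mem_sup_right (Submodule.mem_span_singleton_self v)
      have := Submodule.finrank_lt_finrank_of_lt hlt
      omega

end Net

/-! ### Consequences of the lower-mass condition -/

section LowerMass

variable {n d : ℕ} {c : ℝ} {M₀ : Set (E n)} {μ₀ : Measure (E n)}

lemma integral_norm_starProjection_sq_le [IsProbabilityMeasure μ₀] (V : Submodule ℝ (E n))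
    {a : ℝ} (h : ∀ᵐ x ∂μ₀, ‖V.starProjection x‖ ≤ a) :
    ∫ x, ‖V.starProjection x‖ ^ 2 ∂μ₀ ≤ a ^ 2 := by
  have h1 := norm_integral_le_of_norm_le_const (μ := μ₀) (C := a ^ 2)
    (f := fun x => ‖V.starProjection x‖ ^ 2) (by
      filter_upwards [h] with x hx
      rw [Real.norm_of_nonneg (by positivity)]
      gcongr)
  simpa using (le_abs_self _).trans h1

/-- A set with the lower-mass property is well approximated by a subspace of the reduced
dimension. -/
lemma exists_submodule_finrank_eq_pcaDim [IsProbabilityMeasure μ₀] (hd : 0 < d) (hc : 0 < c)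
    (hM : M₀ ⊆ Metric.closedBall 0 1) (hμ : ∀ᵐ x ∂μ₀, x ∈ M₀) (hmass : LowerMass c d M₀ μ₀)
    {ε₀ : ℝ} (hε : 0 < ε₀) :
    ∃ U : Submodule ℝ (E n), Module.finrank ℝ U = pcaDim n d c ε₀ ∧
      ∫ x, ‖Uᗮ.starProjection x‖ ^ 2 ∂μ₀ ≤ 4 * ε₀ ^ 2 ∧
      ∫ x, ‖Uᗮ.starProjection x‖ ^ 2 ∂μ₀ ≤ 1 := by
  have hone : ∀ U : Submodule ℝ (E n), ∫ x, ‖Uᗮ.starProjection x‖ ^ 2 ∂μ₀ ≤ 1 := fun U => by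
    refine (integral_norm_starProjection_sq_le _ ?_).trans_eq (one_pow 2)
    filter_upwards [hμ] with x hx
    exact (Submodule.norm_starProjection_apply_le _ x).trans (by simpa using hM hx)
  have hext : ∀ K : Submodule ℝ (E n), Module.finrank ℝ K ≤ pcaDim n d c ε₀ →
      ∃ U : Submodule ℝ (E n), K ≤ U ∧ Module.finrank ℝ U = pcaDim n d c ε₀ := fun K hK => by
    obtain ⟨U, h1, h2⟩ := exists_submodule_ge_finrank_eq K (pcaDim n d c ε₀ - Module.finrank ℝ K)
      (by
        rw [Nat.add_sub_cancel' hK, finrank_euclideanSpace_fin]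
        exact min_le_left _ _)
    exact ⟨U, h1, by omega⟩
  -- Lower mass is available only for radii up to `2`; beyond that the trivial risk bound `1 ≤ 4
  -- ε₀²` suffices.
  rcases le_total ε₀ 2 with hε2 | hε2
  · have hβ : 0 < c * unitBallVolume d * ε₀ ^ d :=
      mul_pos (mul_pos hc (unitBallVolume_pos hd)) (pow_pos hε d)
    obtain ⟨t, ht, hcov⟩ := exists_finset_cover μ₀ M₀ hβ fun x hx => hmass x hx ε₀ hε hε2
    have hK : Module.finrank ℝ (Submodule.span ℝ (t : Set (E n))) ≤ pcaDim n d c ε₀ := by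
      refine le_min ?_ ?_
      · simpa using (Submodule.span ℝ (t : Set (E n))).finrank_le
      · refine (finrank_span_finset_le_card t).trans ?_
        rw [← Nat.cast_le (α := ℝ)]
        refine le_trans ?_ (Nat.le_ceil _)
        rw [← mul_inv, ← mul_inv, ← one_div, le_div_iff₀ hβ]
        exact ht
    obtain ⟨U, hKU, hU⟩ := hext _ hK
    refine ⟨U, hU, ?_, hone U⟩
    refine (integral_norm_starProjection_sq_le (a := 2 * ε₀) _ ?_).trans_eq (by ring)
    filter_upwards [hμ] with x hx
    obtain ⟨y, hy, hxy⟩ := hcov x hx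
    have hyU : Uᗮ.starProjection y = 0 := by
      rw [Submodule.starProjection_orthogonal_val, Submodule.starProjection_eq_self_iff.2
        (hKU (Submodule.subset_span hy)), sub_self]
    calc ‖Uᗮ.starProjection x‖ = ‖Uᗮ.starProjection (x - y)‖ := by rw [map_sub, hyU, sub_zero]
      _ ≤ ‖x - y‖ := Submodule.norm_starProjection_apply_le _ _
      _ ≤ 2 * ε₀ := by rwa [← dist_eq_norm]
  · obtain ⟨U, -, hU⟩ := hext ⊥ (by simp)
    exact ⟨U, hU, (hone U).trans (by nlinarith), hone U⟩

/-- Under the lower-mass condition, a small mean squared distance to an affine subspace forces a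
small uniform distance. -/
lemma infDist_le_of_integral_infDist_sq_le [IsProbabilityMeasure μ₀] (hd : 0 < d) (hc : 0 < c)
    (hM : M₀ ⊆ Metric.closedBall 0 1) (hμ : ∀ᵐ x ∂μ₀, x ∈ M₀) (hmass : LowerMass c d M₀ μ₀)
    {S : Set (E n)} {a : ℝ} (ha : ∫ x, Metric.infDist x S ^ 2 ∂μ₀ ≤ a)
    (h3 : ∫ x, Metric.infDist x S ^ 2 ∂μ₀ ≤ 3) {x : E n} (hx : x ∈ M₀) :
    Metric.infDist x S ≤ 2 * d * (a / c) ^ (1 / ((d : ℝ) + 2)) := by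
  set r := Metric.infDist x S with hr
  have hd' : (0 : ℝ) < d := by exact_mod_cast hd
  have ha0 : 0 ≤ a := le_trans (integral_nonneg fun _ => sq_nonneg _) ha
  have hlip : ∀ u v : E n, Metric.infDist u S ≤ Metric.infDist v S + dist u v :=
    fun u v => Metric.infDist_le_infDist_add_dist
  have hint : Integrable (fun u => Metric.infDist u S ^ 2) μ₀ := by
    refine Integrable.of_bound (C := (Metric.infDist 0 S + 1) ^ 2)
      (((Metric.continuous_infDist_pt S).pow 2).aestronglyMeasurable) ?_
    filter_upwards [hμ] with u hu
    rw [Real.norm_of_nonneg (sq_nonneg _)]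
    have h1 : dist u 0 ≤ 1 := hM hu
    exact pow_le_pow_left₀ Metric.infDist_nonneg ((hlip u 0).trans (by linarith)) 2
  -- Ensures that the radius `r / 2` is admissible for lower mass. If `r ≥ 4`, all of `M₀`, of
  -- diameter at most `2`, lies at distance at least `2` from `S`, so the risk is at least `4`.
  have hr4 : r < 4 := by
    by_contra! hr4
    have h4 : (4 : ℝ) ≤ ∫ u, Metric.infDist u S ^ 2 ∂μ₀ := by
      calc (4 : ℝ) = ∫ _, (4 : ℝ) ∂μ₀ := by simp
        _ ≤ _ := by
          refine integral_mono_ae (integrable_const _) hint ?_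
          filter_upwards [hμ] with u hu
          have h1 : dist x u ≤ 2 := by
            have h2 : dist x 0 ≤ 1 := hM hx
            have h3 : dist u 0 ≤ 1 := hM hu
            linarith [dist_triangle_right x u 0]
          have h2 : 2 ≤ Metric.infDist u S := by linarith [hlip x u]
          nlinarith
    linarith
  rcases (Metric.infDist_nonneg (x := x) (s := S)).eq_or_lt with h0 | h0
  · rw [hr, ← h0]
    positivity
  have hlow := hmass x hx (r / 2) (by linarith) (by linarith)
  have hmarkov : (r / 2) ^ 2 * (c * unitBallVolume d * (r / 2) ^ d) ≤ a := by
    refine le_trans ?_ ((mul_meas_ge_le_integral_of_nonneg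
      (Filter.Eventually.of_forall fun _ => sq_nonneg _) hint ((r / 2) ^ 2)).trans ha)
    gcongr
    refine hlow.le.trans (measureReal_mono fun u hu => ?_)
    have h1 : dist x u ≤ r / 2 := by rw [dist_comm]; exact hu
    have h2 : r / 2 ≤ Metric.infDist u S := by linarith [hlip x u]
    exact pow_le_pow_left₀ (by linarith) h2 2
  have hω := unitBallVolume_pos hd
  have hpow : (r / (2 * d)) ^ (d + 2) ≤ a / c := by
    rw [le_div_iff₀ hc]
    refine le_trans ?_ hmarkov
    have h1 : (r / (2 * d)) ^ (d + 2) * (d : ℝ) ^ (d + 2) = (r / 2) ^ (d + 2) := by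
      rw [← mul_pow]
      congr 1
      field_simp
    have h2 : (1 : ℝ) ≤ unitBallVolume d * (d : ℝ) ^ (d + 2) := by
      refine (one_le_unitBallVolume_mul_pow hd).trans ?_
      gcongr
      · exact_mod_cast hd
      · omega
    calc (r / (2 * d)) ^ (d + 2) * c
        ≤ (r / (2 * d)) ^ (d + 2) * c * (unitBallVolume d * (d : ℝ) ^ (d + 2)) :=
          le_mul_of_one_le_right (by positivity) h2
      _ = ((r / (2 * d)) ^ (d + 2) * (d : ℝ) ^ (d + 2)) * (c * unitBallVolume d) := by ring
      _ = _ := by rw [h1]; ring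
  have hroot : r / (2 * d) ≤ (a / c) ^ (1 / ((d : ℝ) + 2)) := by
    have h1 := Real.rpow_le_rpow (by positivity) hpow
      (show (0 : ℝ) ≤ ((d + 2 : ℕ) : ℝ)⁻¹ by positivity)
    rw [Real.pow_rpow_inv_natCast (by positivity) (by omega)] at h1
    refine h1.trans_eq ?_
    push_cast
    rw [one_div]
  rw [div_le_iff₀ (by positivity)] at hroot
  linarith

end LowerMass

/-! ### Moments of the truncated observations -/

section Observation

variable {n : ℕ} {σ r : ℝ} {μ₀ : Measure (E n)}

/-- A noisy observation whose noise has been truncated at radius `r`. -/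
noncomputable def obs (r : ℝ) (p : E n × E n) : E n := p.1 + trunc r p.2

@[fun_prop]
lemma measurable_obs : Measurable (obs r : E n × E n → E n) := by
  unfold obs
  fun_prop

lemma norm_obs_le (hr : 0 ≤ r) {p : E n × E n} (hp : ‖p.1‖ ≤ 1) : ‖obs r p‖ ≤ r + 1 :=
  (norm_add_le _ _).trans (by linarith [norm_trunc_le hr p.2])

lemma integrable_inner_sq {A : Type*} [MeasurableSpace A] {ν : Measure A} [IsFiniteMeasure ν]
    {f : A → E n} (hf : Measurable f) {b : ℝ} (hb : ∀ᵐ a ∂ν, ‖f a‖ ≤ b) (v : E n) :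
    Integrable (fun a => (inner ℝ (f a) v) ^ 2) ν := by
  refine Integrable.of_bound (C := (b * ‖v‖) ^ 2) (by fun_prop) ?_
  filter_upwards [hb] with a ha
  rw [norm_pow]
  gcongr
  exact (norm_inner_le_norm _ _).trans (by gcongr)

lemma ae_prod_norm_fst_le (hμ : ∀ᵐ x ∂μ₀, ‖x‖ ≤ 1) :
    ∀ᵐ p ∂(μ₀.prod (isoGaussian n σ)), ‖p.1‖ ≤ 1 :=
  Measure.quasiMeasurePreserving_fst.ae hμ

variable [IsProbabilityMeasure μ₀]

lemma integrable_trunc (hr : 0 ≤ r) : Integrable (trunc r) (isoGaussian n σ) :=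
  Integrable.of_bound (by fun_prop) r (Filter.Eventually.of_forall (norm_trunc_le hr))

lemma integral_obs (hr : 0 ≤ r) (hμ : ∀ᵐ x ∂μ₀, ‖x‖ ≤ 1) :
    ∫ p, obs r p ∂(μ₀.prod (isoGaussian n σ)) = ∫ x, x ∂μ₀ := by
  have hint : Integrable (fun x : E n => x) μ₀ := Integrable.of_bound (by fun_prop) 1 hμ
  unfold obs
  rw [integral_add (hint.comp_fst _) ((integrable_trunc hr).comp_snd _),
    integral_fun_fst (fun x : E n => x), integral_fun_snd (trunc r), integral_trunc_isoGaussian]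
  simp

lemma integrable_tensorSq_obs (hr : 0 ≤ r) (hμ : ∀ᵐ x ∂μ₀, ‖x‖ ≤ 1) :
    Integrable (fun p => tensorSq (obs r p)) (μ₀.prod (isoGaussian n σ)) := by
  refine Integrable.of_bound (C := (r + 1) ^ 2)
    (continuous_tensorSq.measurable.comp measurable_obs).aestronglyMeasurable ?_
  filter_upwards [ae_prod_norm_fst_le hμ] with p hp
  rw [norm_tensorSq]
  exact pow_le_pow_left₀ (norm_nonneg _) (norm_obs_le hr hp) 2

/-- The cross term vanishes since the truncated noise is centred and independent of the signal. -/
lemma integral_inner_obs_sq (hr : 0 ≤ r) (hμ : ∀ᵐ x ∂μ₀, ‖x‖ ≤ 1) (v : E n) :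
    ∫ p, (inner ℝ (obs r p) v) ^ 2 ∂(μ₀.prod (isoGaussian n σ)) =
      ∫ x, (inner ℝ x v) ^ 2 ∂μ₀ + ∫ z, (inner ℝ (trunc r z) v) ^ 2 ∂(isoGaussian n σ) := by
  have hint : Integrable (fun x : E n => x) μ₀ := Integrable.of_bound (by fun_prop) 1 hμ
  have h1 : Integrable (fun x : E n => (inner ℝ x v) ^ 2) μ₀ :=
    integrable_inner_sq measurable_id hμ v
  have h2 : Integrable (fun z : E n => (inner ℝ (trunc r z) v) ^ 2) (isoGaussian n σ) :=
    integrable_inner_sq measurable_trunc (Filter.Eventually.of_forall (norm_trunc_le hr)) v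
  have h3 : Integrable (fun x : E n => inner ℝ x v) μ₀ := hint.inner_const v
  have h4 : Integrable (fun z : E n => inner ℝ (trunc r z) v) (isoGaussian n σ) :=
    (integrable_trunc hr).inner_const v
  have h5 : ∫ z, inner ℝ (trunc r z) v ∂(isoGaussian n σ) = 0 := by
    simp_rw [real_inner_comm v]
    rw [integral_inner (integrable_trunc hr), integral_trunc_isoGaussian, inner_zero_right]
  have hexp : ∀ p : E n × E n, (inner ℝ (obs r p) v) ^ 2 = (inner ℝ p.1 v) ^ 2 +
      (inner ℝ (trunc r p.2) v) ^ 2 + 2 * (inner ℝ p.1 v * inner ℝ (trunc r p.2) v) := fun p => by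
    rw [obs, inner_add_left]
    ring
  simp_rw [hexp]
  have i1 := h1.comp_fst (isoGaussian n σ)
  have i2 := h2.comp_snd μ₀
  have i12 : Integrable (fun p : E n × E n => (inner ℝ p.1 v) ^ 2 + (inner ℝ (trunc r p.2) v) ^ 2)
      (μ₀.prod (isoGaussian n σ)) := i1.add i2
  rw [integral_add i12 ((h3.mul_prod h4).const_mul 2), integral_add i1 i2,
    integral_const_mul, integral_prod_mul (fun x : E n => inner ℝ x v) (fun z : E n => inner ℝ (trunc r z) v), h5,
    integral_fun_fst (fun x : E n => (inner ℝ x v) ^ 2),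
    integral_fun_snd (fun z : E n => (inner ℝ (trunc r z) v) ^ 2)]
  simp

/-- The second-moment tensor of the truncated observations is that of the clean data, up to an
isotropic term. -/
lemma exists_inner_integral_tensorSq_obs (hr : 0 ≤ r) (hμ : ∀ᵐ x ∂μ₀, ‖x‖ ≤ 1) :
    ∃ s : ℝ, ∀ V : Submodule ℝ (E n),
      inner ℝ (∫ p, tensorSq (obs r p) ∂(μ₀.prod (isoGaussian n σ))) (projTensor V) =
        ∫ x, ‖V.starProjection x‖ ^ 2 ∂μ₀ + Module.finrank ℝ V * s := by
  obtain ⟨s, hs⟩ := exists_integral_inner_trunc_sq_eq n σ r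
  refine ⟨s, fun V => ?_⟩
  have h1 : ∀ v : E n, Integrable (fun x : E n => (inner ℝ x v) ^ 2) μ₀ :=
    integrable_inner_sq measurable_id hμ
  have hT := integrable_tensorSq_obs (σ := σ) hr hμ
  simp_rw [norm_sq_starProjection_eq_sum]
  rw [integral_finsetSum _ fun k _ => h1 _, projTensor, inner_sum]
  have hk : ∀ k, inner ℝ (∫ p, tensorSq (obs r p) ∂(μ₀.prod (isoGaussian n σ)))
      (tensorSq (stdOrthonormalBasis ℝ V k : E n)) =
      ∫ x, (inner ℝ x (stdOrthonormalBasis ℝ V k : E n)) ^ 2 ∂μ₀ + s := fun k => by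
    rw [real_inner_comm, ← integral_inner hT]
    simp_rw [real_inner_comm, inner_tensorSq]
    rw [integral_inner_obs_sq hr hμ, hs]
    rw [← Submodule.coe_norm, (stdOrthonormalBasis ℝ V).norm_eq_one]
  simp_rw [hk, Finset.sum_add_distrib]
  simp

end Observation

/-- Transfers the probability estimates to a product measure on sample space. -/
lemma hasLaw_pi_prod {Ω A B : Type*} [MeasurableSpace Ω] [MeasurableSpace A] [MeasurableSpace B]
    {P : Measure Ω} [IsProbabilityMeasure P] {μ : Measure A} {ν : Measure B}
    [IsProbabilityMeasure μ] [IsProbabilityMeasure ν] {N : ℕ} {X : Fin N → Ω → A}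
    {Z : Fin N → Ω → B} (hX : ∀ i, HasLaw (X i) μ P) (hZ : ∀ i, HasLaw (Z i) ν P)
    (hXi : iIndepFun X P) (hZi : iIndepFun Z P)
    (hXZ : IndepFun (fun ω i => X i ω) (fun ω i => Z i ω) P) :
    HasLaw (fun ω i => (X i ω, Z i ω)) (Measure.pi fun _ : Fin N => μ.prod ν) P :=
  ((measurePreserving_arrowProdEquivProdArrow A B (Fin N) (fun _ => μ)
    (fun _ => ν)).symm).fun_comp_hasLaw
      (hXZ.hasLaw_prod (hXi.hasLaw_pi hX) (hZi.hasLaw_pi hZ))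

/-! ### Probability of bad samples, and the risk on good ones -/

section Samples

variable {n : ℕ} {σ r α τ : ℝ} {μ₀ : Measure (E n)} [IsProbabilityMeasure μ₀]

lemma measure_pi_tensorSq_deviation_le (hr : 0 ≤ r) (hμ : ∀ᵐ x ∂μ₀, ‖x‖ ≤ 1) {N : ℕ} (hN : 0 < N)
    (hτ : 0 ≤ τ) :
    (Measure.pi fun _ : Fin N => μ₀.prod (isoGaussian n σ))
      {a | 2 * (r + 1) ^ 2 * √N * τ ≤ ‖∑ i, (tensorSq (obs r (a i)) -
        ∫ p, tensorSq (obs r p) ∂(μ₀.prod (isoGaussian n σ)))‖} ≤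
      ENNReal.ofReal (2 * Real.exp (-τ ^ 2 / 2)) := by
  set M := ∫ p, tensorSq (obs r p) ∂(μ₀.prod (isoGaussian n σ)) with hMdef
  have hb : ∀ᵐ p ∂(μ₀.prod (isoGaussian n σ)), ‖tensorSq (obs r p)‖ ≤ (r + 1) ^ 2 := by
    filter_upwards [ae_prod_norm_fst_le hμ] with p hp
    rw [norm_tensorSq]
    exact pow_le_pow_left₀ (norm_nonneg _) (norm_obs_le hr hp) 2
  have hM : ‖M‖ ≤ (r + 1) ^ 2 := by simpa using norm_integral_le_of_norm_le_const hb
  refine measure_pi_norm_sum_ge_le (φ := fun p => tensorSq (obs r p) - M)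
    ((continuous_tensorSq.measurable.comp measurable_obs).sub_const M) (by positivity) ?_ ?_ hN hτ
  · filter_upwards [hb] with p hp
    exact (norm_sub_le _ _).trans (by linarith)
  · rw [integral_sub (integrable_tensorSq_obs hr hμ) (integrable_const _)]
    simp [hMdef]

lemma measure_pi_obs_deviation_le (hr : 0 ≤ r) (hμ : ∀ᵐ x ∂μ₀, ‖x‖ ≤ 1) {N : ℕ} (hN : 0 < N)
    (hτ : 0 ≤ τ) :
    (Measure.pi fun _ : Fin N => μ₀.prod (isoGaussian n σ))
      {a | 2 * (r + 1) * √N * τ ≤ ‖∑ i, (obs r (a i) - ∫ x, x ∂μ₀)‖} ≤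
      ENNReal.ofReal (2 * Real.exp (-τ ^ 2 / 2)) := by
  have hb : ∀ᵐ p ∂(μ₀.prod (isoGaussian n σ)), ‖obs r p‖ ≤ r + 1 := by
    filter_upwards [ae_prod_norm_fst_le hμ] with p hp using norm_obs_le hr hp
  have hint : Integrable (obs r) (μ₀.prod (isoGaussian n σ)) :=
    Integrable.of_bound (by fun_prop) _ hb
  rw [← integral_obs (σ := σ) hr hμ]
  set m := ∫ p, obs r p ∂(μ₀.prod (isoGaussian n σ)) with hm_def
  have hm : ‖m‖ ≤ r + 1 := by simpa using norm_integral_le_of_norm_le_const hb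
  refine measure_pi_norm_sum_ge_le (φ := fun p => obs r p - m)
    (by fun_prop) (by positivity) ?_ ?_ hN hτ
  · filter_upwards [hb] with p hp
    exact (norm_sub_le _ _).trans (by linarith)
  · rw [integral_sub hint (integrable_const _)]
    simp [hm_def]

/-- Union bound: taking `u = log (4N / α)` in the Gaussian tail gives `α / (4N)` per sample. -/
lemma measure_pi_exists_norm_snd_gt_le {N : ℕ} (hN : 0 < N) (hσ : 0 < σ) (hα : 0 < α)
    (hα1 : α < 1) :
    (Measure.pi fun _ : Fin N => μ₀.prod (isoGaussian n σ))
      {a | ∃ i, truncRadius 4 n N σ α < ‖(a i).2‖} ≤ ENNReal.ofReal (α / 4) := by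
  have hN' : (1 : ℝ) ≤ N := by exact_mod_cast hN
  set r := truncRadius 4 n N σ α with hr_def
  set u := Real.log (4 * N / α) with hu
  have hu0 : 0 ≤ u := Real.log_nonneg (by rw [le_div_iff₀ hα]; linarith)
  have hr0 : 0 ≤ r := by rw [hr_def, truncRadius]; positivity
  have hr : σ ^ 2 * (2 * n + 4 * u) ≤ r ^ 2 := by
    have h1 : r ^ 2 = 16 * σ ^ 2 * (√(n : ℝ) ^ 2 + 2 * √(n : ℝ) * √u + √u ^ 2) := by
      rw [hr_def, truncRadius]
      ring
    rw [h1, Real.sq_sqrt (Nat.cast_nonneg n), Real.sq_sqrt hu0]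
    have h2 : (0 : ℝ) ≤ σ ^ 2 * (√(n : ℝ) * √u) := by positivity
    have h3 : (0 : ℝ) ≤ σ ^ 2 * n := by positivity
    have h4 : (0 : ℝ) ≤ σ ^ 2 * u := by positivity
    linarith
  have hone : ∀ i : Fin N, (Measure.pi fun _ : Fin N => μ₀.prod (isoGaussian n σ))
      {a | r < ‖(a i).2‖} ≤ ENNReal.ofReal (α / (4 * N)) := by
    intro i
    have hms : MeasurableSet {z : E n | r < ‖z‖} := measurableSet_lt (by fun_prop) (by fun_prop)
    have hmp := (measurePreserving_snd (μ := μ₀) (ν := isoGaussian n σ)).comp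
      (measurePreserving_eval (fun _ : Fin N => μ₀.prod (isoGaussian n σ)) i)
    have h1 := hmp.measure_preimage hms.nullMeasurableSet
    refine (le_of_eq h1).trans ((isoGaussian_norm_gt_le hσ hr0 hr).trans (le_of_eq ?_))
    rw [hu, Real.exp_neg, Real.exp_log (by positivity), inv_div]
  have hset : {a : Fin N → E n × E n | ∃ i, r < ‖(a i).2‖} = ⋃ i, {a | r < ‖(a i).2‖} := by
    ext a
    simp
  rw [hset]
  refine (measure_iUnion_fintype_le _ _).trans ((Finset.sum_le_sum fun i _ => hone i).trans ?_)
  rw [Finset.sum_const, Finset.card_univ, Fintype.card_fin, nsmul_eq_mul,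
    ← ENNReal.ofReal_natCast, ← ENNReal.ofReal_mul (by positivity)]
  apply le_of_eq
  congr 1
  field_simp

/-- The samples for which some signal lies outside of the unit ball, some noise vector exceeds the
radius `r`, or the empirical first or second moments deviate by more than `τ` standard scales. -/
def badSamples (μ₀ : Measure (E n)) (σ r τ : ℝ) (N : ℕ) : Set (Fin N → E n × E n) :=
  {a | 2 * (r + 1) ^ 2 * √N * τ ≤ ‖∑ i, (tensorSq (obs r (a i)) -
      ∫ p, tensorSq (obs r p) ∂(μ₀.prod (isoGaussian n σ)))‖} ∪
    {a | 2 * (r + 1) * √N * τ ≤ ‖∑ i, (obs r (a i) - ∫ x, x ∂μ₀)‖} ∪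
    {a | ∃ i, r < ‖(a i).2‖} ∪ {a | ¬ ∀ i, ‖(a i).1‖ ≤ 1}

lemma measure_pi_badSamples_le (hμ : ∀ᵐ x ∂μ₀, ‖x‖ ≤ 1) {N : ℕ} (hN : 0 < N) (hσ : 0 < σ)
    (hα : 0 < α) (hα1 : α < 1) :
    (Measure.pi fun _ : Fin N => μ₀.prod (isoGaussian n σ))
      (badSamples μ₀ σ (truncRadius 4 n N σ α) √(2 * Real.log (4 / α)) N) ≤
        ENNReal.ofReal (4 * α) := by
  have hr : 0 ≤ truncRadius 4 n N σ α := by rw [truncRadius]; positivity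
  have hlog : 0 ≤ Real.log (4 / α) := Real.log_nonneg (by rw [le_div_iff₀ hα]; linarith)
  have hexp : 2 * Real.exp (-√(2 * Real.log (4 / α)) ^ 2 / 2) = α / 2 := by
    rw [Real.sq_sqrt (by positivity), neg_div, mul_div_cancel_left₀ _ two_ne_zero, Real.exp_neg,
      Real.exp_log (by positivity), inv_div]
    ring
  have h1 := measure_pi_tensorSq_deviation_le (σ := σ) hr hμ hN
    (Real.sqrt_nonneg (2 * Real.log (4 / α)))
  have h2 := measure_pi_obs_deviation_le (σ := σ) hr hμ hN
    (Real.sqrt_nonneg (2 * Real.log (4 / α)))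
  have h3 := measure_pi_exists_norm_snd_gt_le (n := n) (μ₀ := μ₀) hN hσ hα hα1
  have h4 : (Measure.pi fun _ : Fin N => μ₀.prod (isoGaussian n σ))
      {a | ¬ ∀ i, ‖(a i).1‖ ≤ 1} = 0 := by
    have hall : ∀ᵐ a ∂(Measure.pi fun _ : Fin N => μ₀.prod (isoGaussian n σ)),
        ∀ i, ‖(a i).1‖ ≤ 1 :=
      ae_all_iff.2 fun i => (Measure.quasiMeasurePreserving_eval
        (fun _ : Fin N => μ₀.prod (isoGaussian n σ)) i).ae
          (p := fun p : E n × E n => ‖p.1‖ ≤ 1) (ae_prod_norm_fst_le hμ)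
    exact hall
  rw [hexp] at h1 h2
  -- The four parts contribute `α/2`, `α/2`, `α/4` and `0`.
  refine (measure_union_le _ _).trans ((add_le_add (measure_union_le _ _) h4.le).trans ?_)
  refine (add_le_add (add_le_add (measure_union_le _ _) h3) le_rfl).trans ?_
  refine (add_le_add (add_le_add (add_le_add h1 h2) le_rfl) le_rfl).trans ?_
  rw [add_zero, ← ENNReal.ofReal_add (by positivity) (by positivity),
    ← ENNReal.ofReal_add (by positivity) (by positivity)]
  exact ENNReal.ofReal_le_ofReal (by linarith)

lemma integral_infDist_sq_le_of_notMem_badSamples (hμ : ∀ᵐ x ∂μ₀, ‖x‖ ≤ 1) {N D : ℕ} (hN : 0 < N)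
    (hr : 0 ≤ r) (hτ : 0 ≤ τ) {a : Fin N → E n × E n} (ha : a ∉ badSamples μ₀ σ r τ N)
    {S : AffineSubspace ℝ (E n)} (hS : IsPCAFit D (fun i => (a i).1 + (a i).2) S)
    {U : Submodule ℝ (E n)} (hU : Module.finrank ℝ U = D) :
    ∫ x, Metric.infDist x S ^ 2 ∂μ₀ ≤ ∫ x, ‖Uᗮ.starProjection x‖ ^ 2 ∂μ₀ +
      2 * (2 * (r + 1) ^ 2 * ((√(D : ℝ) + 2) / √(N : ℝ)) * (1 + τ)) := by
  have hN' : (0 : ℝ) < N := by exact_mod_cast hN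
  have hsN : 0 < √(N : ℝ) := Real.sqrt_pos.2 hN'
  simp only [badSamples, Set.mem_union, Set.mem_ofPred_eq, not_or, not_exists, not_lt, not_le,
    not_not] at ha
  obtain ⟨⟨⟨h1, h2⟩, h3⟩, h4⟩ := ha
  have hobs : ∀ i, (a i).1 + (a i).2 = obs r (a i) := fun i => by
    rw [obs, trunc_of_norm_le (h3 i)]
  simp_rw [hobs] at hS
  obtain ⟨s, hs⟩ := exists_inner_integral_tensorSq_obs (σ := σ) hr hμ
  have hNs : ∀ x : ℝ, N * (x / √(N : ℝ)) = x * √N := fun x => by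
    have : √(N : ℝ) * √(N : ℝ) = N := Real.mul_self_sqrt hN'.le
    field_simp
    rw [sq, this]
    ring
  have key := integral_infDist_sq_le_of_isPCAFit hN hμ hS U hU
    (M := ∫ p, tensorSq (obs r p) ∂(μ₀.prod (isoGaussian n σ))) (s := D * s)
    (fun V hV => by rw [hs V, hV]) (ρ := r + 1) (Δ := 2 * (r + 1) ^ 2 * τ / √N)
    (δ := 2 * (r + 1) * τ / √N) (fun i => norm_obs_le hr (h4 i))
    (by rw [hNs]; linarith) (by rw [hNs]; linarith)
  refine key.trans ?_
  -- The deviation terms use only `(√D + 1) τ` out of `(√D + 2)(1 + τ)`; the rest is nonnegative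
  -- slack.
  have h5 : 2 * (2 * (r + 1) ^ 2 * ((√(D : ℝ) + 2) / √(N : ℝ)) * (1 + τ)) =
      2 * √(D : ℝ) * (2 * (r + 1) ^ 2 * τ / √N) + 2 * (r + 1) * (2 * (r + 1) * τ / √N) +
        4 * (r + 1) ^ 2 * (√(D : ℝ) + 2 + τ) / √N := by
    field_simp
    ring
  have h6 : 0 ≤ 4 * (r + 1) ^ 2 * (√(D : ℝ) + 2 + τ) / √N := by positivity
  linarith

end Samples

end ManifoldPCA

/-! ### The main theorem -/

theorem mainTheorem2 :
    ∃ C : ℝ, 1 ≤ C ∧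
      ∀ (n d N₀ : ℕ) (c ε₀ σ α : ℝ) (M₀ : Set (ManifoldPCA.E n))
        (μ₀ : MeasureTheory.Measure (ManifoldPCA.E n))
        [MeasureTheory.IsProbabilityMeasure μ₀],
        0 < d → 0 < N₀ → 0 < c → Real.exp 1 < c⁻¹ → 0 < ε₀ → 0 < σ → 0 < α → α < 1 →
        M₀ ⊆ Metric.closedBall 0 1 →
        (∀ᵐ x ∂μ₀, x ∈ M₀) →
        ManifoldPCA.LowerMass c d M₀ μ₀ →
        ∀ (D : ℕ), D = ManifoldPCA.pcaDim n d c ε₀ →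
        ∀ (εemp : ℝ),
          εemp = ManifoldPCA.epsEmp (ManifoldPCA.truncRadius C n N₀ σ α) D N₀ α →
          εemp ≤ 1 →
        ∀ (Ω : Type*) [MeasurableSpace Ω] (P : MeasureTheory.Measure Ω)
          [MeasureTheory.IsProbabilityMeasure P] (X Z : Fin N₀ → Ω → ManifoldPCA.E n),
          (∀ i, ProbabilityTheory.HasLaw (X i) μ₀ P) →
          (∀ i, ProbabilityTheory.HasLaw (Z i) (ManifoldPCA.isoGaussian n σ) P) →
          ProbabilityTheory.iIndepFun X P →
          ProbabilityTheory.iIndepFun Z P →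
          ProbabilityTheory.IndepFun (fun ω i => X i ω) (fun ω i => Z i ω) P →
        ∀ (S : Ω → AffineSubspace ℝ (ManifoldPCA.E n)) [∀ ω, Nonempty (S ω)],
          (∀ ω, ManifoldPCA.IsPCAFit D (fun i => X i ω + Z i ω) (S ω)) →
          P {ω | C * d * ((4 * ε₀ ^ 2 + 2 * εemp) / c) ^ (1 / ((d : ℝ) + 2)) ≤
              Metric.hausdorffDist M₀
                ((fun x => (EuclideanGeometry.orthogonalProjection (S ω) x : ManifoldPCA.E n))
                  '' M₀)}
            ≤ ENNReal.ofReal (C * α) := by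
  -- The value `4` serves the noise tail in `truncRadius`, the probability bound, and strictly
  -- exceeds the factor `2` of the uniform distance bound.
  refine ⟨4, by norm_num, ?_⟩
  intro n d N₀ c ε₀ σ α M₀ μ₀ _ hd hN hc _ hε hσ hα hα1 hM hμM hmass D hD εemp hεemp hεemp1
    Ω _ P _ X Z hX hZ hXi hZi hXZ S _ hS
  have hμ : ∀ᵐ x ∂μ₀, ‖x‖ ≤ 1 := by
    filter_upwards [hμM] with x hx
    simpa using hM hx
  have hr : 0 ≤ ManifoldPCA.truncRadius 4 n N₀ σ α := by
    rw [ManifoldPCA.truncRadius]; positivity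
  have hlaw := ManifoldPCA.hasLaw_pi_prod hX hZ hXi hZi hXZ
  have hεemp0 : 0 ≤ εemp := by
    rw [hεemp, ManifoldPCA.epsEmp]; positivity
  -- The bad set does not depend on `S`, so no measurability of `S` is needed;
  -- `Measure.le_map_apply` holds for arbitrary sets.
  refine le_trans (measure_mono (t := (fun ω i => (X i ω, Z i ω)) ⁻¹' ManifoldPCA.badSamples μ₀ σ
    (ManifoldPCA.truncRadius 4 n N₀ σ α) √(2 * Real.log (4 / α)) N₀) ?_)
    ((Measure.le_map_apply hlaw.aemeasurable _).trans ?_)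
  swap
  · rw [hlaw.map_eq]
    exact ManifoldPCA.measure_pi_badSamples_le hμ hN hσ hα hα1
  intro ω hω
  by_contra hgood
  obtain ⟨U, hU, hU1, hU2⟩ :=
    ManifoldPCA.exists_submodule_finrank_eq_pcaDim hd hc hM hμM hmass hε
  have hrisk := ManifoldPCA.integral_infDist_sq_le_of_notMem_badSamples hμ hN hr
    (Real.sqrt_nonneg (2 * Real.log (4 / α))) hgood (hS ω) (hU.trans hD.symm)
  rw [← ManifoldPCA.epsEmp, ← hεemp] at hrisk
  -- The risk is at most `1 + 2 ε_emp ≤ 3`, which is where `ε_emp ≤ 1` enters.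
  have hdist : ∀ x ∈ M₀, Metric.infDist x (S ω) ≤
      2 * d * ((4 * ε₀ ^ 2 + 2 * εemp) / c) ^ (1 / ((d : ℝ) + 2)) := fun x hx =>
    ManifoldPCA.infDist_le_of_integral_infDist_sq_le hd hc hM hμM hmass (by linarith)
      (by linarith) hx
  have hpos : 0 < (d : ℝ) * ((4 * ε₀ ^ 2 + 2 * εemp) / c) ^ (1 / ((d : ℝ) + 2)) := by positivity
  have hH : Metric.hausdorffDist M₀
      ((fun x => (EuclideanGeometry.orthogonalProjection (S ω) x : ManifoldPCA.E n)) '' M₀) ≤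
      2 * d * ((4 * ε₀ ^ 2 + 2 * εemp) / c) ^ (1 / ((d : ℝ) + 2)) := by
    refine Metric.hausdorffDist_le_of_mem_dist (by linarith) (fun x hx => ?_) ?_
    · refine ⟨_, Set.mem_image_of_mem _ hx, ?_⟩
      rw [EuclideanGeometry.dist_orthogonalProjection_eq_infDist]
      exact hdist x hx
    · rintro _ ⟨x, hx, rfl⟩
      refine ⟨x, hx, ?_⟩
      rw [dist_comm, EuclideanGeometry.dist_orthogonalProjection_eq_infDist]
      exact hdist x hx
  have hω' : 4 * d * ((4 * ε₀ ^ 2 + 2 * εemp) / c) ^ (1 / ((d : ℝ) + 2)) ≤ _ := hω.trans hH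
  linarith
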